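/- Let $1\le k<D$, let items $1,\dots,D$ have probabilities $f_1\ge\dots\ge f_k>f_{k+1}\ge\dots\ge f_D\ge 0$ with $\sum_{i=1}^D f_i=1$, put $F_k=\sum_{i=1}^k f_i$, and let $X_1,X_2,\dots$ be an i.i.d. stream of items with $\Pr[X_t=i]=f_i$. Space Saving with $m\ge 1$ counters starts with an empty table; an arriving item that has a counter increments it; otherwise, if fewer than $m$ counters are in use, it gets a new counter with value $1$; otherwise it replaces an item whose counter value $c$ is minimal and receives the counter value $c+1$. Ties for the minimum may be broken by any (measurable, possibly random or time-dependent) rule. The top-$k$ is identified at time $t$ if, after the $t$-th arrival, items $1,\dots,k$ all have counters and each of these counters is larger than the counter of every other item in the table; let $P_{m,k}(t)$ be the probability of this event. Say that Space Saving eventually identifies the top-$k$ with probability $1$ if, almost surely, there is a (random) time from which on the top-$k$ is identified at every time. (a) If $m>k$, then Space Saving eventually identifies the top-$k$ with probability $1$ if and only if $$f_k>\frac{1-F_k}{m-k}.$$ (b) If $m>k$ or $F_k<1$, then Space Saving eventually identifies the top-$k$ with probability $1$ if and only if $$m>k+\frac{1-F_k}{f_k}.$$ (c) If $m>k+\frac{1-F_k}{f_k}$,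 then $\lim_{t\to\infty}P_{m,k}(t)=1$; if $m<k+\frac{1-F_k}{f_k}$, then $P_{m,k}(t)$ does not converge to $1$. -/

import Mathlib

open MeasureTheory ProbabilityTheory Filter Topology

namespace SpaceSaving

/-- The state of Space Saving over the domain `{1, …, D}`; the index `i : Fin D` stands for the item
`i + 1`. A state assigns to every item its counter. Monitored items have a counter that is at least
`1`, and the value `0` means that the item is not in the table. -/
abbrev Table (D : ℕ) : Type := Fin D → ℕ

/-- The set `C` of the monitored items. -/
def monitored {D : ℕ} (c : Table D) : Finset (Fin D) := Finset.univ.filter fun x => c x ≠ 0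

/-- `y` is a monitored item of minimal counter: a possible value of `argmin_{y ∈ C} c_y`. -/
def IsArgmin {D : ℕ} (c : Table D) (y : Fin D) : Prop :=
  y ∈ monitored c ∧ ∀ z ∈ monitored c, c y ≤ c z

/-- Arrival of the item `x`, for a table of `m` counters, where `y` is the item of minimal counter
that has to leave if `x` is not monitored and all counters are in use. -/
def add {D : ℕ} (m : ℕ) (c : Table D) (y x : Fin D) : Table D :=
  if x ∈ monitored c then Function.update c x (c x + 1)
  else if (monitored c).card < m then Function.update c x 1
  else Function.update (Function.update c y 0) x (c y + 1)

/-- The table after the first `t` elements `x 0, …, x (t - 1)` of the stream, starting from the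
empty table. The value `evict t c` is the choice of `argmin c` when the element `x t` arrives. -/
def run {D : ℕ} (m : ℕ) (evict : ℕ → Table D → Fin D) (x : ℕ → Fin D) : ℕ → Table D
  | 0 => fun _ => 0
  | t + 1 => add m (run m evict x t) (evict t (run m evict x t)) (x t)

/-- The `k` largest counters are allocated to the items `1, …, k`: all these items are monitored and
each of their counters exceeds the counter of every other item. -/
def Identifies {D : ℕ} (k : ℕ) (c : Table D) : Prop :=
  (∀ i : Fin D, (i : ℕ) < k → i ∈ monitored c) ∧
    ∀ i j : Fin D, (i : ℕ) < k → k ≤ (j : ℕ) → c j < c i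

/-- `F_k = f_1 + … + f_k`. -/
noncomputable def topMass (f : ℕ → ℝ) (k : ℕ) : ℝ := ∑ i ∈ Finset.Icc 1 k, f i

/-- With probability one, the top `k` items are identified at all sufficiently late times. -/
def EventuallyIdentifies {Ω : Type*} [MeasurableSpace Ω] (μ : Measure Ω) {D : ℕ} (k m : ℕ)
    (evict : ℕ → Ω → Table D → Fin D) (X : ℕ → Ω → Fin D) : Prop :=
  ∀ᵐ ω ∂μ, ∀ᶠ t in atTop, Identifies k (run m (fun s => evict s ω) (fun s => X s ω) t)

/-- The probability that the top `k` items are identified after the arrival of `t` elements. -/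
noncomputable def identifyProb {Ω : Type*} [MeasurableSpace Ω] (μ : Measure Ω) {D : ℕ} (k m : ℕ)
    (evict : ℕ → Ω → Table D → Fin D) (X : ℕ → Ω → Fin D) (t : ℕ) : ℝ :=
  μ.real {ω | Identifies k (run m (fun s => evict s ω) (fun s => X s ω) t)}

end SpaceSaving

/-!
Everything about the table is proved for each stream and each tie-breaking rule separately, so the
rule may even depend on the future of the stream. Write `n_i(t)` for the number of occurrences of
the item `i` and `F` for `F_k`. The counters of the table always add up to `t`.

*Sufficiency.* A monitored item has a counter at least `n_i`, and an unmonitored item has `n_i` at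
most the minimal counter `L`. Distributing `t` over the counters gives the residual bound
`(m - k) L ≤ t - ∑_{i ≤ k} n_i(t)` (`IsLevel.residual`). By the strong law of large numbers `L` grows
at rate at most `(1 - F) / (m - k) < f_k`, so the top items are eventually monitored for ever. The
counter of another item `j` is at most a minimal counter at an earlier time plus the number of
arrivals of `j` since then (`run_add_occ_le`), hence grows at rate at most
`max ((1 - F) / (m - k)) f_{k+1} < f_k` (`eventually_identifies`).

*Necessity.* Let `B(t)` be the number of times up to `t` at which the top `k` is not identified. At
all other times the top items are counted exactly, which gives `c_i(t) ≤ n_i(t) + B(t)` for the top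
items. When the top `k` is identified at time `t`, the remaining `m - k` counters are below `c_k(t)`,
so that `t ≤ ∑_{i ≤ k} n_i(t) + (m - k) n_k(t) + m B(t)` (`Identifies.le_occ_add_failures`). If the
probability of identification tends to `1`, then the mean of `B(t) / t` tends to `0`, and taking
expectations yields `1 ≤ F + (m - k) f_k` (`le_of_tendsto_identifyProb`). If the top `k` is
eventually identified, then `B` is bounded. In the critical case `1 = F + (m - k) f_k` this would
bound above the martingale `t - ∑_{i ≤ k} n_i(t) - (m - k) n_k(t)`, whose increments are bounded; it
would converge, although its increments are infinitely often equal to `-(m - k)`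
(`not_eventuallyIdentifies_of_critical`).
-/

namespace SpaceSaving

/-! ### One arrival -/

section Step

variable {D : ℕ} {m : ℕ} {c : Table D} {x y : Fin D}

theorem mem_monitored {c : Table D} {z : Fin D} : z ∈ monitored c ↔ c z ≠ 0 := by
  simp [monitored]

/-- `L` is a lower bound for the value that an arriving unmonitored item inherits: it is `0` while
there are free counters, and at most the minimal counter once the table is full. -/
def IsLevel (m : ℕ) (c : Table D) (L : ℕ) : Prop :=
  L = 0 ∨ (m ≤ (monitored c).card ∧ ∀ z, c z ≠ 0 → L ≤ c z)

/-- The three ways in which a table changes: an increment, a new counter, a replacement. -/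
theorem add_cases (hm : 0 < m) (hy : (monitored c).Nonempty → IsArgmin c y) (x : Fin D) :
    (c x ≠ 0 ∧ add m c y x = Function.update c x (c x + 1)) ∨
    (c x = 0 ∧ (monitored c).card < m ∧ add m c y x = Function.update c x 1) ∨
    (c x = 0 ∧ m ≤ (monitored c).card ∧ c y ≠ 0 ∧ y ≠ x ∧ (∀ z, c z ≠ 0 → c y ≤ c z) ∧
      add m c y x = Function.update (Function.update c y 0) x (c y + 1)) := by
  unfold add
  by_cases h1 : x ∈ monitored c
  · exact Or.inl ⟨mem_monitored.1 h1, by simp [h1]⟩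
  · have hx : c x = 0 := by simpa [mem_monitored] using h1
    by_cases h2 : (monitored c).card < m
    · exact Or.inr (Or.inl ⟨hx, h2, by simp [h1, h2]⟩)
    · have hne : (monitored c).Nonempty := Finset.card_pos.1 (by omega)
      obtain ⟨hy1, hy2⟩ := hy hne
      rw [mem_monitored] at hy1
      refine Or.inr (Or.inr ⟨hx, by omega, hy1, ?_, ?_, by simp [h1, h2]⟩)
      · rintro rfl; exact hy1 hx
      · intro z hz; exact hy2 z (mem_monitored.2 hz)

theorem sum_add (hm : 0 < m) (hy : (monitored c).Nonempty → IsArgmin c y) (x : Fin D) :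
    ∑ i, add m c y x i = ∑ i, c i + 1 := by
  have key : ∀ (d : Table D) (z : Fin D) (v : ℕ),
      ∑ i, Function.update d z v i + d z = ∑ i, d i + v := by
    intro d z v
    rw [Finset.sum_update_of_mem (Finset.mem_univ z),
      ← Finset.sum_sdiff (Finset.subset_univ {z}) (f := d), Finset.sum_singleton]
    ring
  rcases add_cases hm hy x with ⟨-, h⟩ | ⟨h0, -, h⟩ | ⟨h0, -, -, hyx, -, h⟩ <;> rw [h]
  · have := key c x (c x + 1); omega
  · have := key c x 1; omega
  · have h1 := key c y 0
    have h2 := key (Function.update c y 0) x (c y + 1)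
    rw [Function.update_of_ne hyx.symm] at h2
    omega

theorem card_monitored_add (hm : 0 < m) (hy : (monitored c).Nonempty → IsArgmin c y) (x : Fin D) :
    (monitored (add m c y x)).card =
      if c x = 0 ∧ (monitored c).card < m then (monitored c).card + 1 else (monitored c).card := by
  rcases add_cases hm hy x with ⟨hx, h⟩ | ⟨h0, hc, h⟩ | ⟨h0, hc, hy0, hyx, -, h⟩ <;> rw [h]
  · rw [if_neg (by tauto)]
    congr 1
    ext z
    by_cases hz : z = x
    · subst hz; simp [mem_monitored, hx]
    · simp [mem_monitored, hz]
  · rw [if_pos ⟨h0, hc⟩, ← Finset.card_insert_of_notMem (a := x) (by simp [mem_monitored, h0])]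
    congr 1
    ext z
    by_cases hz : z = x
    · subst hz; simp [mem_monitored]
    · simp [mem_monitored, hz]
  · rw [if_neg (by omega)]
    have : monitored (Function.update (Function.update c y 0) x (c y + 1)) =
        insert x ((monitored c).erase y) := by
      ext z
      by_cases hz : z = x
      · subst hz; simp [mem_monitored]
      · by_cases hz' : z = y
        · subst hz'; simp [mem_monitored, hz]
        · simp [mem_monitored, hz, hz']
    rw [this, Finset.card_insert_of_notMem (by simp [mem_monitored, h0]),
      Finset.card_erase_of_mem (mem_monitored.2 hy0)]
    omega

/-- The minimal counter never decreases. -/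
theorem IsLevel.step {L : ℕ} (hL : IsLevel m c L) (hm : 0 < m)
    (hy : (monitored c).Nonempty → IsArgmin c y) (x : Fin D) : IsLevel m (add m c y x) L := by
  rcases hL with h0 | ⟨hc, hL⟩
  · exact Or.inl h0
  refine Or.inr ⟨?_, fun z => ?_⟩
  · rw [card_monitored_add hm hy]; split_ifs <;> omega
  rcases add_cases hm hy x with ⟨hx, h⟩ | ⟨h0, hc, h⟩ | ⟨h0, hc, hy0, hyx, hmin, h⟩
  · rw [h]
    have := hL x hx
    by_cases hz : z = x
    · subst hz; simp; omega
    · simpa [hz] using hL z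
  · omega
  · rw [h]
    have := hL y hy0
    by_cases hz : z = x
    · subst hz; simp; omega
    · by_cases hz' : z = y
      · subst hz'; simp [hz]
      · simpa [hz, hz'] using hL z

/-- The minimal counter increases by at most one. -/
theorem IsLevel.of_step {L : ℕ} (hm : 0 < m) (hy : (monitored c).Nonempty → IsArgmin c y)
    (hL : IsLevel m (add m c y x) L) : IsLevel m c (L - 1) := by
  rcases hL with h0 | ⟨hcard, hL⟩
  · exact Or.inl (by omega)
  rcases add_cases hm hy x with ⟨hx, h⟩ | ⟨h0, hc, h⟩ | ⟨h0, hc, hy0, hyx, hmin, h⟩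
  · refine Or.inr ⟨?_, fun z hz0 => ?_⟩
    · rw [card_monitored_add hm hy, if_neg (by tauto)] at hcard; exact hcard
    have := hL z
    rw [h] at this
    by_cases hz : z = x
    · subst hz; simp at this; omega
    · simp [hz] at this; have := this hz0; omega
  · have := hL x
    rw [h] at this
    simp at this
    exact Or.inl (by omega)
  · refine Or.inr ⟨hc, fun z hz0 => ?_⟩
    have := hL x
    rw [h] at this
    simp at this
    have := hmin z hz0
    omega

end Step

/-! ### Bounds along a run -/

/-- The number of occurrences of the item `i` among the first `t` elements of the stream. -/
def occ {D : ℕ} (x : ℕ → Fin D) (i : Fin D) (t : ℕ) : ℕ :=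
  ∑ s ∈ Finset.range t, if x s = i then 1 else 0

/-- The top `k` items. -/
def top (D k : ℕ) : Finset (Fin D) := Finset.univ.filter fun i => (i : ℕ) < k

section Run

variable {D : ℕ} {m k : ℕ} {evict : ℕ → Table D → Fin D} {x : ℕ → Fin D}

theorem occ_succ (x : ℕ → Fin D) (i : Fin D) (t : ℕ) :
    occ x i (t + 1) = occ x i t + if x t = i then 1 else 0 := by
  rw [occ, Finset.sum_range_succ, ← occ]

theorem sum_occ (x : ℕ → Fin D) (t : ℕ) : ∑ i, occ x i t = t := by
  unfold occ
  rw [Finset.sum_comm]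
  simp

theorem card_top (h : k ≤ D) : (top D k).card = k := by
  have : top D k = (Finset.univ : Finset (Fin k)).map (Fin.castLEEmb h) := by
    ext i
    simp only [top, Finset.mem_filter, Finset.mem_univ, true_and, Finset.mem_map]
    constructor
    · intro hi; exact ⟨⟨i, hi⟩, rfl⟩
    · rintro ⟨j, rfl⟩; exact j.2
  rw [this, Finset.card_map, Finset.card_fin]

theorem sum_run (hm : 0 < m) (hev : ∀ t c, (monitored c).Nonempty → IsArgmin c (evict t c))
    (t : ℕ) : ∑ i, run m evict x t i = t := by
  induction t with
  | zero => simp [run]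
  | succ t ih => rw [run, sum_add hm (hev t _), ih]

theorem card_monitored_run_le (hm : 0 < m)
    (hev : ∀ t c, (monitored c).Nonempty → IsArgmin c (evict t c)) (t : ℕ) :
    (monitored (run m evict x t)).card ≤ m := by
  induction t with
  | zero => simp [run, monitored]
  | succ t ih => rw [run, card_monitored_add hm (hev t _)]; split_ifs <;> omega

/-- A monitored item has a counter at least its number of occurrences, and an unmonitored item has
occurred at most as often as the minimal counter says. -/
theorem occ_le_run (hm : 0 < m) (hev : ∀ t c, (monitored c).Nonempty → IsArgmin c (evict t c))
    (t : ℕ) (i : Fin D) :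
    (run m evict x t i ≠ 0 → occ x i t ≤ run m evict x t i) ∧
      (run m evict x t i = 0 → IsLevel m (run m evict x t) (occ x i t)) := by
  induction t with
  | zero => simp [run, occ, IsLevel]
  | succ t ih =>
    have hlev := fun L (hL : IsLevel m (run m evict x t) L) => hL.step hm (hev t _) (x t)
    rw [run, occ_succ]
    generalize run m evict x t = c at ih hlev ⊢
    rcases add_cases hm (hev t c) (x t) with ⟨hx, h⟩ | ⟨h0, hc, h⟩ | ⟨h0, hc, hy0, hyx, hmin, h⟩
    · by_cases hi : x t = i
      · subst hi
        rw [h]; simpa using ih.1 hx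
      · refine ⟨?_, ?_⟩
        · rw [h]; simpa [hi, Ne.symm hi] using ih.1
        · intro h'; rw [h] at h'
          simpa [hi] using hlev _ (ih.2 (by simpa [Ne.symm hi] using h'))
    · by_cases hi : x t = i
      · subst hi
        rcases ih.2 h0 with h1 | h1
        · rw [h]; simp [h1]
        · omega
      · refine ⟨?_, ?_⟩
        · rw [h]; simpa [hi, Ne.symm hi] using ih.1
        · intro h'; rw [h] at h'
          simpa [hi] using hlev _ (ih.2 (by simpa [Ne.symm hi] using h'))
    · by_cases hi : x t = i
      · subst hi
        rw [h]
        rcases ih.2 h0 with h1 | ⟨-, h1⟩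
        · simp [h1]
        · simpa using h1 _ hy0
      · by_cases hiy : i = evict t c
        · refine ⟨by intro h'; rw [h] at h'; simp [hiy, hyx] at h', fun _ => ?_⟩
          simp only [hi, if_false, add_zero]
          have hle := ih.1 (hiy ▸ hy0)
          apply hlev
          refine Or.inr ⟨hc, fun z hz => hle.trans ?_⟩
          rw [hiy]; exact hmin z hz
        · refine ⟨?_, ?_⟩
          · rw [h]; simpa [hi, Ne.symm hi, hiy] using ih.1
          · intro h'; rw [h] at h'
            simpa [hi] using hlev _ (ih.2 (by simpa [Ne.symm hi, hiy] using h'))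

/-- The residual bound for the minimal counter: `(m - k) L ≤ t - ∑_{i ≤ k} n_i(t)`. -/
theorem IsLevel.residual {L t : ℕ} (hL : IsLevel m (run m evict x t) L) (hm : 0 < m)
    (hev : ∀ t c, (monitored c).Nonempty → IsArgmin c (evict t c)) (hkD : k ≤ D)
    (hkm : k ≤ m) : ∑ i ∈ top D k, occ x i t + m * L ≤ t + k * L := by
  have hocc := occ_le_run (x := x) hm hev t
  have hsum := sum_run (x := x) hm hev t
  have hcardle := card_monitored_run_le (x := x) hm hev t
  rcases hL with rfl | ⟨hcard, hL⟩
  · have : ∑ i ∈ top D k, occ x i t ≤ ∑ i, occ x i t :=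
      Finset.sum_le_sum_of_subset (Finset.subset_univ _)
    rw [sum_occ] at this
    simpa using this
  generalize run m evict x t = c at *
  obtain ⟨y, hy, hmin⟩ := Finset.exists_min_image (monitored c) c
    (Finset.card_pos.1 (by omega))
  rw [mem_monitored] at hy
  have hLy := hL y hy
  -- monitored top items are charged to their own counters, the others to minimal counters
  have h1 : ∑ i ∈ top D k ∩ monitored c, occ x i t ≤ ∑ i ∈ top D k ∩ monitored c, c i :=
    Finset.sum_le_sum fun i hi =>
      (hocc i).1 (mem_monitored.1 (Finset.mem_inter.1 hi).2)
  have h2 : ∑ i ∈ top D k \ monitored c, occ x i t ≤ (top D k \ monitored c).card * c y := by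
    rw [← smul_eq_mul]
    refine Finset.sum_le_card_nsmul _ _ _ fun i hi => ?_
    have hi0 : c i = 0 := by simpa [mem_monitored] using (Finset.mem_sdiff.1 hi).2
    rcases (hocc i).2 hi0 with h | ⟨-, h⟩
    · omega
    · exact h y hy
  have h3 : (monitored c \ top D k).card * c y ≤ ∑ i ∈ monitored c \ top D k, c i := by
    rw [← smul_eq_mul]
    exact Finset.card_nsmul_le_sum _ _ _ fun i hi => hmin i (Finset.mem_sdiff.1 hi).1
  have h4 : ∑ i ∈ monitored c, c i = t := by
    rw [← hsum]
    refine Finset.sum_subset (Finset.subset_univ _) fun i _ hi => ?_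
    simpa [mem_monitored] using hi
  have h5 := Finset.sum_inter_add_sum_sdiff (top D k) (monitored c) fun i => occ x i t
  have h6 := Finset.sum_inter_add_sum_sdiff (monitored c) (top D k) fun i => c i
  have h7 := Finset.card_inter_add_card_sdiff (top D k) (monitored c)
  have h8 := Finset.card_inter_add_card_sdiff (monitored c) (top D k)
  rw [Finset.inter_comm (monitored c)] at h6 h8
  rw [card_top hkD] at h7
  have h9 : (monitored c).card = m := by omega
  rw [h9] at h8
  rw [h4] at h6
  rw [← h5]
  set a := (top D k ∩ monitored c).card
  set b := (top D k \ monitored c).card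
  set d := (monitored c \ top D k).card
  obtain ⟨e, he⟩ := Nat.exists_eq_add_of_le (show b ≤ d by omega)
  have h10 : e * L ≤ e * c y := Nat.mul_le_mul le_rfl hLy
  rw [he] at h3 h8
  have h11 : m * L = k * L + e * L := by rw [← h8, ← h7]; ring
  rw [add_mul] at h3
  linarith

/-- A monitored item inherited a minimal counter when it entered, and has been counted exactly
since then. -/
theorem run_add_occ_le (hm : 0 < m)
    (hev : ∀ t c, (monitored c).Nonempty → IsArgmin c (evict t c)) (t : ℕ) (i : Fin D)
    (hi : run m evict x t i ≠ 0) :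
    ∃ s ≤ t, ∃ L, IsLevel m (run m evict x s) L ∧
      run m evict x t i + occ x i s ≤ L + occ x i t := by
  induction t with
  | zero => simp [run] at hi
  | succ t ih =>
    rw [run] at hi
    rw [run, occ_succ]
    -- the step changes the counter of `i` by the arrivals of `i`, unless `i` enters now
    by_cases h0 : run m evict x t i = 0
    · rcases add_cases hm (hev t (run m evict x t)) (x t) with
        ⟨hx, h⟩ | ⟨hx, hc, h⟩ | ⟨hx, hc, hy0, hyx, hmin, h⟩
      · have hxi : x t ≠ i := by rintro rfl; exact hx h0
        rw [h] at hi; simp [Ne.symm hxi, h0] at hi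
      · have hxi : x t = i := by
          by_contra hxi; rw [h] at hi; simp [Ne.symm hxi, h0] at hi
        refine ⟨t, by omega, 0, Or.inl rfl, ?_⟩
        rw [h, hxi]; simp; omega
      · have hxi : x t = i := by
          by_contra hxi
          rw [h, Function.update_of_ne (Ne.symm hxi)] at hi
          by_cases hiy : i = evict t (run m evict x t)
          · rw [hiy] at h0; exact hy0 h0
          · simp [hiy, h0] at hi
        refine ⟨t, by omega, _, Or.inr ⟨hc, hmin⟩, ?_⟩
        rw [h, hxi]; simp; omega
    · obtain ⟨s, hs, L, hL, hle⟩ := ih h0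
      refine ⟨s, by omega, L, hL, ?_⟩
      rcases add_cases hm (hev t (run m evict x t)) (x t) with
        ⟨hx, h⟩ | ⟨hx, hc, h⟩ | ⟨hx, hc, hy0, hyx, hmin, h⟩
      · rw [h]
        by_cases hxi : x t = i
        · subst hxi; simp; omega
        · simp [hxi, Ne.symm hxi]; omega
      · have hxi : x t ≠ i := by rintro rfl; exact h0 hx
        rw [h]; simp [hxi, Ne.symm hxi]; omega
      · have hxi : x t ≠ i := by rintro rfl; exact h0 hx
        rw [h] at hi ⊢
        by_cases hiy : i = evict t (run m evict x t)
        · simp [hiy, hyx] at hi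
        · simp [hxi, Ne.symm hxi, hiy]; omega

open scoped Classical in
/-- The number of times up to `t` at which the top `k` items are not identified. -/
noncomputable def failures (k m : ℕ) (evict : ℕ → Table D → Fin D) (x : ℕ → Fin D) (t : ℕ) : ℕ :=
  ∑ s ∈ Finset.range (t + 1), if Identifies k (run m evict x s) then 0 else 1

open scoped Classical in
/-- Counters of top items and the minimal counter exceed the number of occurrences of a top item
by at most the number of failures: as long as a top item is monitored it is counted exactly, and
otherwise the top items are not identified. -/
theorem run_le_occ_add_failures (hm : 0 < m)
    (hev : ∀ t c, (monitored c).Nonempty → IsArgmin c (evict t c)) (t : ℕ) (i : Fin D)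
    (hi : (i : ℕ) < k) :
    run m evict x t i ≤ occ x i t + failures k m evict x t ∧
      ∀ L, IsLevel m (run m evict x t) L → L ≤ occ x i t + failures k m evict x t := by
  induction t with
  | zero =>
    simp only [run, zero_le, true_and]
    rintro L (h | ⟨h, -⟩)
    · omega
    · simp [monitored] at h; omega
  | succ t ih =>
    have hf : failures k m evict x (t + 1) = failures k m evict x t +
        if Identifies k (run m evict x (t + 1)) then 0 else 1 := by
      rw [failures, Finset.sum_range_succ, ← failures]
    have hlev := fun L (hL : IsLevel m (run m evict x (t + 1)) L) =>
      ih.2 _ (hL.of_step hm (hev t _))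
    have hcases := add_cases hm (hev t (run m evict x t)) (x t)
    rw [← run] at hcases
    by_cases hg : Identifies k (run m evict x (t + 1))
    · have hi1 : run m evict x (t + 1) i ≠ 0 := mem_monitored.1 (hg.1 i hi)
      have hmain : run m evict x (t + 1) i ≤ occ x i (t + 1) + failures k m evict x (t + 1) := by
        rw [hf, if_pos hg, occ_succ]
        rcases hcases with ⟨hx, h⟩ | ⟨hx, hc, h⟩ | ⟨hx, hc, hy0, hyx, hmin, h⟩
        · rw [h]
          by_cases hxi : x t = i
          · subst hxi; simp; omega
          · simp [hxi, Ne.symm hxi]; omega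
        · rw [h]
          by_cases hxi : x t = i
          · subst hxi; simp; omega
          · simp [hxi, Ne.symm hxi]; omega
        · have h2 := ih.2 _ (Or.inr ⟨hc, hmin⟩)
          rw [h] at hi1 ⊢
          by_cases hxi : x t = i
          · subst hxi; simp; omega
          · by_cases hiy : i = evict t (run m evict x t)
            · simp [hiy, hyx] at hi1
            · simp [hxi, Ne.symm hxi, hiy]; omega
      refine ⟨hmain, ?_⟩
      rintro L (h | ⟨-, h⟩)
      · omega
      · exact (h i hi1).trans hmain
    · rw [hf, if_neg hg, occ_succ]
      refine ⟨?_, fun L hL => by have := hlev L hL; omega⟩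
      rcases hcases with ⟨hx, h⟩ | ⟨hx, hc, h⟩ | ⟨hx, hc, hy0, hyx, hmin, h⟩
      · rw [h]
        by_cases hxi : x t = i
        · subst hxi; simp; omega
        · simp [hxi, Ne.symm hxi]; omega
      · rw [h]
        by_cases hxi : x t = i
        · subst hxi; simp; omega
        · simp [hxi, Ne.symm hxi]; omega
      · have h2 := ih.2 _ (Or.inr ⟨hc, hmin⟩)
        rw [h]
        by_cases hxi : x t = i
        · subst hxi; simp; omega
        · by_cases hiy : i = evict t (run m evict x t)
          · simp [hiy, Ne.symm hyx, hyx]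
          · simp [hxi, Ne.symm hxi, hiy]; omega

theorem Identifies.le_of_card_le {c : Table D} (h : Identifies k c) (hkD : k ≤ D)
    (hc : (monitored c).card ≤ m) : k ≤ m := by
  rw [← card_top hkD]
  refine (Finset.card_le_card fun i hi => h.1 i ?_).trans hc
  simpa [top] using hi

/-- At a time when the top `k` items are identified, their counters and the at most `m - k` others,
each of which is less than the counter of any top item `i`, make up the whole stream. -/
theorem Identifies.le_occ_add_failures {t : ℕ} (h : Identifies k (run m evict x t)) (hm : 0 < m)
    (hev : ∀ t c, (monitored c).Nonempty → IsArgmin c (evict t c)) (hkD : k ≤ D) (i : Fin D)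
    (hi : (i : ℕ) < k) :
    t ≤ ∑ j ∈ top D k, occ x j t + (m - k) * occ x i t + m * failures k m evict x t := by
  have hle := fun j hj => (run_le_occ_add_failures (x := x) (k := k) hm hev t j hj).1
  have hcard := card_monitored_run_le (x := x) hm hev t
  have hsum := sum_run (x := x) hm hev t
  generalize run m evict x t = c at *
  generalize failures k m evict x t = B at *
  have hkm := h.le_of_card_le hkD hcard
  have hsub : top D k ⊆ monitored c := fun j hj => h.1 j (by simpa [top] using hj)
  have h4 : ∑ j ∈ monitored c, c j = t := by
    rw [← hsum]
    refine Finset.sum_subset (Finset.subset_univ _) fun i _ hi => ?_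
    simpa [mem_monitored] using hi
  have h1 : ∑ j ∈ top D k, c j ≤ ∑ j ∈ top D k, (occ x j t + B) :=
    Finset.sum_le_sum fun j hj => hle j (by simpa [top] using hj)
  have h2 : ∑ j ∈ monitored c \ top D k, c j ≤ (monitored c \ top D k).card * c i := by
    rw [← smul_eq_mul]
    refine Finset.sum_le_card_nsmul _ _ _ fun j hj => (h.2 i j hi ?_).le
    simpa [top] using (Finset.mem_sdiff.1 hj).2
  have h3 := Finset.card_sdiff_of_subset hsub
  rw [card_top hkD] at h3
  have h5 := Finset.sum_sdiff (f := c) hsub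
  rw [Finset.sum_add_distrib, Finset.sum_const, card_top hkD, smul_eq_mul] at h1
  have h6 : (monitored c \ top D k).card * c i ≤ (m - k) * (occ x i t + B) :=
    Nat.mul_le_mul (by omega) (hle i hi)
  obtain ⟨e, rfl⟩ := Nat.exists_eq_add_of_le hkm
  rw [Nat.add_sub_cancel_left] at *
  nlinarith

end Run

/-! ### Streams with given frequencies -/

theorem exists_forall_abs_sub_le {u : ℕ → ℝ} {a ε : ℝ}
    (h : Tendsto (fun t : ℕ => u t / t) atTop (𝓝 a)) (hε : 0 < ε) :
    ∃ C, 0 ≤ C ∧ ∀ t : ℕ, |u t - a * t| ≤ ε * t + C := by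
  obtain ⟨N, hN⟩ := (Metric.tendsto_atTop.1 h) ε hε
  refine ⟨∑ s ∈ Finset.range (N + 1), |u s - a * s|,
    Finset.sum_nonneg fun _ _ => abs_nonneg _, fun t => ?_⟩
  by_cases ht : t < N + 1
  · have := Finset.single_le_sum (f := fun s : ℕ => |u s - a * s|) (fun _ _ => abs_nonneg _)
      (Finset.mem_range.2 ht)
    have : 0 ≤ ε * t := by positivity
    linarith
  · have h1 := hN t (by omega)
    have ht0 : (0 : ℝ) < t := by exact_mod_cast (by omega : 0 < t)
    have h2 : u t - a * t = (u t / t - a) * t := by field_simp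
    have h3 : 0 ≤ ∑ s ∈ Finset.range (N + 1), |u s - a * s| :=
      Finset.sum_nonneg fun _ _ => abs_nonneg _
    rw [Real.dist_eq] at h1
    rw [h2, abs_mul, abs_of_pos ht0]
    nlinarith

/-- If the top items have frequencies at least `a`, and both the frequencies of the other items and
the growth rate of the minimal counter allowed by the residual bound are at most `b < a`, then the
top items are identified from some time on. -/
theorem eventually_identifies {D m k : ℕ} {evict : ℕ → Table D → Fin D} {x : ℕ → Fin D}
    (hev : ∀ t c, (monitored c).Nonempty → IsArgmin c (evict t c)) (hkD : k ≤ D) (hkm : k < m)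
    {p : Fin D → ℝ} (hp : ∀ i, Tendsto (fun t : ℕ => (occ x i t : ℝ) / t) atTop (𝓝 (p i)))
    {a b : ℝ} (hab : b < a) (ha : ∀ i : Fin D, (i : ℕ) < k → a ≤ p i)
    (hb : ∀ j : Fin D, k ≤ (j : ℕ) → p j ≤ b) (hres : 1 - ∑ i ∈ top D k, p i ≤ (m - k) * b) :
    ∀ᶠ t in atTop, Identifies k (run m evict x t) := by
  have hm : 0 < m := by omega
  -- the comparison below costs `k` errors `ε t` for `L`, two for `occ x j`, one for `occ x i`
  obtain ⟨ε, hε, hεab⟩ : ∃ ε : ℝ, 0 < ε ∧ (k + 4) * ε = a - b :=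
    ⟨(a - b) / (k + 4), by have := sub_pos.2 hab; positivity, by field_simp⟩
  choose C' hC'0 hC' using fun i => exists_forall_abs_sub_le (hp i) hε
  obtain ⟨C, hC0, hC⟩ : ∃ C, 0 ≤ C ∧ ∀ i (t : ℕ), |(occ x i t : ℝ) - p i * t| ≤ ε * t + C := by
    refine ⟨∑ i, C' i, Finset.sum_nonneg fun i _ => hC'0 i, fun i t => ?_⟩
    have := Finset.single_le_sum (f := C') (fun i _ => hC'0 i) (Finset.mem_univ i)
    linarith [hC' i t]
  have hkm' : (1 : ℝ) ≤ m - k := by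
    have : (k : ℝ) + 1 ≤ m := by exact_mod_cast hkm
    linarith
  have hlev : ∀ (s L : ℕ), IsLevel m (run m evict x s) L → (L : ℝ) ≤ b * s + k * (ε * s + C) := by
    intro s L hL
    have h1 : (∑ i ∈ top D k, (occ x i s : ℝ)) + m * L ≤ s + k * L := by
      exact_mod_cast hL.residual hm hev hkD hkm.le
    have h2 : ∑ i ∈ top D k, (p i * s - (ε * s + C)) ≤ ∑ i ∈ top D k, (occ x i s : ℝ) :=
      Finset.sum_le_sum fun i _ => by linarith [(abs_le.1 (hC i s)).1]
    rw [Finset.sum_sub_distrib, ← Finset.sum_mul, Finset.sum_const, card_top hkD,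
      nsmul_eq_mul] at h2
    have h3 : 0 ≤ k * (ε * s + C) := by positivity
    have h4 := mul_le_mul_of_nonneg_right hres (Nat.cast_nonneg (α := ℝ) s)
    have h5 : ((m : ℝ) - k) * L ≤ (m - k) * (b * s + k * (ε * s + C)) := by nlinarith
    exact le_of_mul_le_mul_left h5 (by linarith)
  -- for large `t` the gap `(a - b) t` absorbs all the error terms
  have hlarge : ∀ᶠ t : ℕ in atTop, ((k : ℝ) + 4) * C < ε * t := by
    filter_upwards [(tendsto_natCast_atTop_atTop (R := ℝ)).eventually_gt_atTop
      (((k : ℝ) + 4) * C / ε)] with t ht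
    rwa [div_lt_iff₀' hε] at ht
  filter_upwards [hlarge] with t ht
  have hgap : (k + 4) * ε * t = (a - b) * t := by rw [hεab]
  have htop : ∀ i : Fin D, (i : ℕ) < k → a * t - (ε * t + C) ≤ occ x i t := by
    intro i hi
    have := mul_le_mul_of_nonneg_right (ha i hi) (Nat.cast_nonneg (α := ℝ) t)
    linarith [(abs_le.1 (hC i t)).1]
  have hmon : ∀ i : Fin D, (i : ℕ) < k → run m evict x t i ≠ 0 := by
    intro i hi h0
    have h1 := hlev t _ ((occ_le_run hm hev t i).2 h0)
    have h2 := htop i hi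
    nlinarith
  refine ⟨fun i hi => mem_monitored.2 (hmon i hi), fun i j hi hj => ?_⟩
  have h1 := (occ_le_run (x := x) hm hev t i).1 (hmon i hi)
  by_cases hj0 : run m evict x t j = 0
  · rw [hj0]; exact Nat.pos_of_ne_zero (hmon i hi)
  obtain ⟨s, hst, L, hL, hle⟩ := run_add_occ_le hm hev t j hj0
  have h2 := htop i hi
  have h3 := hlev s L hL
  have h4 : (run m evict x t j : ℝ) + occ x j s ≤ L + occ x j t := by exact_mod_cast hle
  have h5 := (abs_le.1 (hC j s)).1
  have h6 := (abs_le.1 (hC j t)).2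
  have hst' : (s : ℝ) ≤ t := by exact_mod_cast hst
  have h7 : p j * (t - s) ≤ b * (t - s) :=
    mul_le_mul_of_nonneg_right (hb j hj) (by linarith)
  have h8 : (k + 1) * ε * s ≤ (k + 1) * ε * t := by gcongr
  have h9 : (run m evict x t j : ℝ) < occ x i t := by nlinarith
  exact lt_of_lt_of_le (by exact_mod_cast h9) h1

/-! ### The random stream -/

section Random

variable {Ω : Type*} [MeasurableSpace Ω] {μ : Measure Ω} [IsProbabilityMeasure μ] {D k m : ℕ}
  {X : ℕ → Ω → Fin D} {p : Fin D → ℝ} {evict : ℕ → Ω → Table D → Fin D}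

theorem integrable_comp_stream (hX : ∀ t, Measurable (X t)) (φ : Fin D → ℝ) (t : ℕ) :
    Integrable (fun ω => φ (X t ω)) μ := by
  have : IsProbabilityMeasure (μ.map (X t)) := Measure.isProbabilityMeasure_map (hX t).aemeasurable
  exact (Integrable.of_finite (μ := μ.map (X t)) (f := φ)).comp_measurable (hX t)

theorem integral_comp_stream (hX : ∀ t, Measurable (X t))
    (hp : ∀ t i, μ.real {ω | X t ω = i} = p i) (φ : Fin D → ℝ) (t : ℕ) :
    ∫ ω, φ (X t ω) ∂μ = ∑ i, p i * φ i := by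
  have : IsProbabilityMeasure (μ.map (X t)) := Measure.isProbabilityMeasure_map (hX t).aemeasurable
  rw [← integral_map (hX t).aemeasurable (Measurable.of_discrete.aestronglyMeasurable),
    integral_fintype .of_finite]
  refine Finset.sum_congr rfl fun i _ => ?_
  rw [map_measureReal_apply (hX t) (measurableSet_singleton i), smul_eq_mul, ← hp t i]
  rfl

theorem identDistrib_stream (hX : ∀ t, Measurable (X t))
    (hp : ∀ t i, μ.real {ω | X t ω = i} = p i) (t : ℕ) : IdentDistrib (X t) (X 0) μ μ := by
  refine ⟨(hX t).aemeasurable, (hX 0).aemeasurable, Measure.ext_of_singleton fun i => ?_⟩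
  rw [Measure.map_apply (hX t) (measurableSet_singleton i),
    Measure.map_apply (hX 0) (measurableSet_singleton i)]
  have := (hp t i).trans (hp 0 i).symm
  exact (measureReal_eq_measureReal_iff).1 this

theorem ae_tendsto_occ_div (hX : ∀ t, Measurable (X t)) (hindep : iIndepFun X μ)
    (hp : ∀ t i, μ.real {ω | X t ω = i} = p i) :
    ∀ᵐ ω ∂μ, ∀ i, Tendsto (fun t : ℕ => (occ (fun s => X s ω) i t : ℝ) / t) atTop (𝓝 (p i)) := by
  rw [ae_all_iff]
  intro i
  have hφ : Measurable fun j : Fin D => if j = i then (1 : ℝ) else 0 := .of_discrete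
  have h := strong_law_ae_real (μ := μ) (fun t ω => if X t ω = i then (1 : ℝ) else 0)
    (integrable_comp_stream hX (fun j => if j = i then (1 : ℝ) else 0) 0)
    (fun s t hst => (hindep.indepFun hst).comp hφ hφ)
    (fun t => (identDistrib_stream hX hp t).comp hφ)
  rw [integral_comp_stream hX hp (fun j => if j = i then (1 : ℝ) else 0) 0] at h
  filter_upwards [h] with ω hω
  simpa [occ] using hω

theorem measurable_run (hX : ∀ t, Measurable (X t)) (hevict : ∀ t c, Measurable fun ω => evict t ω c)
    (t : ℕ) : Measurable fun ω => run m (fun s => evict s ω) (fun s => X s ω) t := by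
  induction t with
  | zero => exact measurable_const
  | succ t ih =>
    have h1 : Measurable fun q : Ω × Table D => evict t q.1 q.2 :=
      measurable_from_prod_countable_left fun c => hevict t c
    have h2 : Measurable fun ω => evict t ω (run m (fun s => evict s ω) (fun s => X s ω) t) :=
      h1.comp (measurable_id.prodMk ih)
    have h3 : Measurable fun q : Table D × Fin D × Fin D => add m q.1 q.2.1 q.2.2 :=
      Measurable.of_discrete
    have h4 := h3.comp (ih.prodMk (h2.prodMk (hX t)))
    simp only [run]
    simpa only [Function.comp_def] using h4

theorem measurableSet_identifies (hX : ∀ t, Measurable (X t))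
    (hevict : ∀ t c, Measurable fun ω => evict t ω c) (t : ℕ) :
    MeasurableSet {ω | Identifies k (run m (fun s => evict s ω) (fun s => X s ω) t)} :=
  measurableSet_preimage (measurable_run (m := m) hX hevict t)
    (MeasurableSet.of_discrete (s := {c : Table D | Identifies k c}))

theorem EventuallyIdentifies.tendsto_identifyProb (h : EventuallyIdentifies μ k m evict X) :
    Tendsto (identifyProb μ k m evict X) atTop (𝓝 1) := by
  set A : ℕ → Set Ω := fun n => {ω | ∀ t ≥ n,
    Identifies k (run m (fun s => evict s ω) (fun s => X s ω) t)}
  have hA : Monotone A := fun a b hab ω hω t ht => hω t (hab.trans ht)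
  have hU : μ (⋃ n, A n) = 1 := by
    rw [← measure_univ (μ := μ)]
    refine measure_congr (eventuallyEq_univ.2 ?_)
    filter_upwards [h] with ω hω
    obtain ⟨n, hn⟩ := eventually_atTop.1 hω
    exact Set.mem_iUnion.2 ⟨n, hn⟩
  have h1 := tendsto_measure_iUnion_atTop (μ := μ) hA
  rw [hU] at h1
  have h2 := (ENNReal.tendsto_toReal ENNReal.one_ne_top).comp h1
  rw [ENNReal.toReal_one] at h2
  refine tendsto_of_tendsto_of_tendsto_of_le_of_le h2 tendsto_const_nhds (fun n => ?_)
    fun n => measureReal_le_one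
  exact measureReal_mono fun ω hω => hω n le_rfl

/-- The contribution of an arriving item `j` to the right-hand side of
`Identifies.le_occ_add_failures`: `1` if `j` is a top item, and `m - k` more if `j = i`. -/
def weight (m k : ℕ) (i j : Fin D) : ℝ :=
  (if (j : ℕ) < k then 1 else 0) + (m - k) * if j = i then 1 else 0

theorem sum_mul_weight (p : Fin D → ℝ) (i : Fin D) :
    ∑ j, p j * weight m k i j = ∑ j ∈ top D k, p j + (m - k) * p i := by
  simp [weight, mul_add, Finset.sum_add_distrib, top, Finset.sum_filter, mul_comm]

theorem sum_weight (x : ℕ → Fin D) (i : Fin D) (t : ℕ) :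
    ∑ s ∈ Finset.range t, weight m k i (x s) =
      ∑ j ∈ top D k, (occ x j t : ℝ) + (m - k) * occ x i t := by
  induction t with
  | zero => simp [occ]
  | succ t ih =>
    rw [Finset.sum_range_succ, ih]
    simp only [occ_succ, Nat.cast_add, Finset.sum_add_distrib, weight]
    have : ∑ j ∈ top D k, (((if x t = j then 1 else 0 : ℕ)) : ℝ) =
        if ((x t : Fin D) : ℕ) < k then 1 else 0 := by simp [top]
    rw [this]
    push_cast
    ring

theorem Identifies.le_sum_weight {x : ℕ → Fin D} {ev : ℕ → Table D → Fin D} {t : ℕ}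
    (h : Identifies k (run m ev x t)) (hm : 0 < m)
    (hev : ∀ t c, (monitored c).Nonempty → IsArgmin c (ev t c)) (hkD : k ≤ D) (i : Fin D)
    (hi : (i : ℕ) < k) :
    (t : ℝ) ≤ ∑ s ∈ Finset.range t, weight m k i (x s) + m * failures k m ev x t := by
  have hkm := h.le_of_card_le hkD (card_monitored_run_le hm hev t)
  rw [sum_weight, ← Nat.cast_sub hkm]
  exact_mod_cast h.le_occ_add_failures hm hev hkD i hi

/-- In expectation, the bound `Identifies.le_occ_add_failures` divided by `t` becomes the inequality
between the probabilities, as the expected proportion of failures tends to `0`. -/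
theorem le_of_tendsto_identifyProb (hX : ∀ t, Measurable (X t))
    (hp : ∀ t i, μ.real {ω | X t ω = i} = p i)
    (hmeas : ∀ t c, Measurable fun ω => evict t ω c) (hm : 0 < m)
    (hev : ∀ t ω c, (monitored c).Nonempty → IsArgmin c (evict t ω c)) (hkD : k ≤ D) (i : Fin D)
    (hi : (i : ℕ) < k) (h : Tendsto (identifyProb μ k m evict X) atTop (𝓝 1)) :
    k ≤ m ∧ 1 ≤ ∑ j ∈ top D k, p j + (m - k) * p i := by
  classical
  have hkm : k ≤ m := by
    obtain ⟨t, ht⟩ := (h.eventually (lt_mem_nhds one_pos)).exists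
    have hne : {ω | Identifies k (run m (fun s => evict s ω) (fun s => X s ω) t)}.Nonempty := by
      by_contra hne
      rw [Set.not_nonempty_iff_eq_empty] at hne
      rw [identifyProb, hne] at ht
      simp at ht
    obtain ⟨ω, hω⟩ := hne
    exact hω.le_of_card_le hkD (card_monitored_run_le hm (fun s c => hev s ω c) t)
  refine ⟨hkm, ?_⟩
  set E := ∑ j ∈ top D k, p j + (m - k) * p i with hE
  set P := identifyProb μ k m evict X with hP
  set G : ℕ → Ω → ℝ := fun t ω =>
    if Identifies k (run m (fun s => evict s ω) (fun s => X s ω) t) then 1 else 0 with hG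
  have hGind : ∀ t, G t = Set.indicator
      {ω | Identifies k (run m (fun s => evict s ω) (fun s => X s ω) t)} 1 := by
    intro t; ext ω; simp [hG, Set.indicator_apply]
  have hset := measurableSet_identifies (k := k) (m := m) hX hmeas
  have hGint : ∀ t, Integrable (G t) μ := by
    intro t
    rw [hGind t]
    exact (integrable_const (1 : ℝ)).indicator (hset t)
  have hGP : ∀ t, ∫ ω, G t ω ∂μ = P t := by
    intro t
    rw [hGind t]
    exact integral_indicator_one (hset t)
  have hpath : ∀ (T : ℕ) ω, T * G T ω ≤ ∑ s ∈ Finset.range T, weight m k i (X s ω) +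
      m * ∑ s ∈ Finset.range (T + 1), (1 - G s ω) := by
    intro T ω
    have hfail : (failures k m (fun s => evict s ω) (fun s => X s ω) T : ℝ) =
        ∑ s ∈ Finset.range (T + 1), (1 - G s ω) := by
      rw [failures, Nat.cast_sum]
      refine Finset.sum_congr rfl fun s _ => ?_
      simp only [hG]
      split_ifs <;> simp
    rw [← hfail]
    by_cases hg : Identifies k (run m (fun s => evict s ω) (fun s => X s ω) T)
    · simpa [hG, hg] using hg.le_sum_weight hm (fun s c => hev s ω c) hkD i hi
    · have hkm' : (0 : ℝ) ≤ m - k := sub_nonneg.2 (by exact_mod_cast hkm)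
      have h0 : 0 ≤ ∑ s ∈ Finset.range T, weight m k i (X s ω) :=
        Finset.sum_nonneg fun s _ => by
          unfold weight; split_ifs <;> simp <;> linarith
      simp only [hG, hg, if_false, mul_zero]
      positivity
  have hW : ∀ s, Integrable (fun ω => weight m k i (X s ω)) μ := fun s =>
    integrable_comp_stream hX _ s
  have hmean : ∀ T : ℕ, T * P T ≤ T * E + m * ∑ s ∈ Finset.range (T + 1), (1 - P s) := by
    intro T
    have h1 : Integrable (fun ω => ∑ s ∈ Finset.range T, weight m k i (X s ω)) μ :=
      integrable_finsetSum _ fun s _ => hW s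
    have h2 : ∀ s ∈ Finset.range (T + 1), Integrable (fun ω => 1 - G s ω) μ := fun s _ =>
      (integrable_const 1).sub (hGint s)
    have h3 := integral_mono ((hGint T).const_mul (T : ℝ))
      (h1.add ((integrable_finsetSum _ h2).const_mul (m : ℝ))) (hpath T)
    simp only [Pi.add_apply] at h3
    rw [integral_const_mul, hGP, integral_add h1 ((integrable_finsetSum _ h2).const_mul (m : ℝ)),
      integral_const_mul, integral_finsetSum _ fun s _ => hW s, integral_finsetSum _ h2] at h3
    simp only [integral_comp_stream hX hp, sum_mul_weight] at h3
    have h4 : ∀ s, ∫ ω, (1 - G s ω) ∂μ = 1 - P s := fun s => by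
      rw [integral_sub (integrable_const 1) (hGint s), hGP]; simp
    simpa only [h4, Finset.sum_const, Finset.card_range, nsmul_eq_mul] using h3
  have hP0 : Tendsto (fun t => 1 - P t) atTop (𝓝 0) := by
    simpa using (tendsto_const_nhds (x := (1 : ℝ))).sub h
  have hbound : ∀ᶠ T : ℕ in atTop, P T ≤ E +
      m * ((T : ℝ)⁻¹ * ∑ s ∈ Finset.range T, (1 - P s)) + m * (1 - P T) := by
    filter_upwards [eventually_ge_atTop 1] with T hT
    have hT' : (1 : ℝ) ≤ T := by exact_mod_cast hT
    have h1 := hmean T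
    rw [Finset.sum_range_succ] at h1
    have h2 : 0 ≤ 1 - P T := sub_nonneg.2 measureReal_le_one
    have h3 : 0 ≤ (m : ℝ) * (1 - P T) := by positivity
    have h4 : (T : ℝ) * ((T : ℝ)⁻¹ * ∑ s ∈ Finset.range T, (1 - P s)) =
        ∑ s ∈ Finset.range T, (1 - P s) := by field_simp
    refine le_of_mul_le_mul_left (a := (T : ℝ)) ?_ (by linarith)
    nlinarith
  have hlim := ((tendsto_const_nhds (x := E)).add (hP0.cesaro.const_mul (m : ℝ))).add
    (hP0.const_mul (m : ℝ))
  simp only [mul_zero, add_zero] at hlim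
  exact le_of_tendsto_of_tendsto h hlim hbound

/-- In the critical case, `t - ∑_{s < t} weight (X s)` is a martingale with bounded integer
increments. Eventual identification bounds it above, so that it converges and its increments
vanish from some time on; but each occurrence of `i` yields the increment `-(m - k)`. -/
theorem not_eventuallyIdentifies_of_critical (hX : ∀ t, Measurable (X t)) (hindep : iIndepFun X μ)
    (hp : ∀ t i, μ.real {ω | X t ω = i} = p i)
    (hev : ∀ t ω c, (monitored c).Nonempty → IsArgmin c (evict t ω c)) (hkD : k ≤ D) (hkm : k < m)
    (i : Fin D) (hi : (i : ℕ) < k) (hpi : 0 < p i)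
    (hcrit : ∑ j ∈ top D k, p j + (m - k) * p i = 1) : ¬ EventuallyIdentifies μ k m evict X := by
  classical
  intro h
  have hkm' : (1 : ℝ) ≤ m - k := by
    have : (k : ℝ) + 1 ≤ m := by exact_mod_cast hkm
    linarith
  set ψ : Fin D → ℝ := fun j => 1 - weight m k i j with hψ
  set ξ : ℕ → Ω → ℝ := fun s ω => ψ (X s ω) with hξ
  have hξm : ∀ s, StronglyMeasurable (ξ s) := fun s =>
    ((Measurable.of_discrete (f := ψ)).comp (hX s)).stronglyMeasurable
  have hξint : ∀ s, Integrable (ξ s) μ := fun s => integrable_comp_stream hX ψ s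
  have hξ0 : ∀ s, ∫ ω, ξ s ω ∂μ = 0 := by
    intro s
    simp only [hξ, hψ]
    rw [integral_sub (integrable_const 1) (integrable_comp_stream hX _ s),
      integral_comp_stream hX hp, sum_mul_weight, hcrit]
    simp
  have hξind : iIndepFun ξ μ := hindep.comp (fun _ => ψ) fun _ => .of_discrete
  set M : ℕ → Ω → ℝ := fun n => ∑ s ∈ Finset.range (n + 1), ξ s with hM
  have hMsucc : ∀ n, M (n + 1) - M n = ξ (n + 1) := by
    intro n
    simp only [hM]
    rw [Finset.sum_range_succ _ (n + 1), add_sub_cancel_left]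
  have hmart : Martingale M (Filtration.natural ξ hξm) μ := by
    refine martingale_of_condExp_sub_eq_zero_nat (fun n => ?_) (fun n => ?_) fun n => ?_
    · refine Finset.stronglyMeasurable_sum _ fun s hs => ?_
      exact (Filtration.stronglyAdapted_natural hξm s).mono
        ((Filtration.natural ξ hξm).mono (by simpa [Nat.lt_succ_iff] using hs))
    · exact integrable_finsetSum' _ fun s _ => hξint s
    · rw [hMsucc]
      refine (hξind.condExp_natural_ae_eq_of_lt hξm (Nat.lt_succ_self n)).trans ?_
      rw [hξ0]; rfl
  have hbdd : ∀ᵐ ω ∂μ, ∀ n, |M (n + 1) ω - M n ω| ≤ ((m : ℝ) - k + 1 : ℝ) := by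
    refine ae_of_all _ fun ω n => ?_
    have : M (n + 1) ω - M n ω = ξ (n + 1) ω := congrFun (hMsucc n) ω
    rw [this, abs_le]
    simp only [hξ, hψ, weight]
    split_ifs <;> constructor <;> linarith
  have hbdd' : ∀ᵐ ω ∂μ, ∀ n, |M (n + 1) ω - M n ω| ≤ (((m : ℝ) - k + 1).toNNReal : ℝ) := by
    rwa [Real.coe_toNNReal _ (by linarith)]
  obtain ⟨ω, hω1, hω2, hω3⟩ := ((hmart.submartingale.bddAbove_iff_exists_tendsto hbdd').and
    (h.and (ae_tendsto_occ_div hX hindep hp))).exists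
  set x : ℕ → Fin D := fun s => X s ω with hx
  set ev : ℕ → Table D → Fin D := fun s => evict s ω with hev'
  obtain ⟨N, hN⟩ := eventually_atTop.1 hω2
  have hMω : ∀ n, M n ω = (n + 1 : ℕ) - ∑ s ∈ Finset.range (n + 1), weight m k i (x s) := by
    intro n
    simp [hM, hξ, hψ, hx]
  have hfail : ∀ n, N ≤ n → failures k m ev x n = failures k m ev x N := by
    intro n hn
    induction n, hn using Nat.le_induction with
    | base => rfl
    | succ n hn ih =>
      rw [← ih, failures, Finset.sum_range_succ, ← failures, if_pos (hN (n + 1) (by omega)),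
        add_zero]
  have hab : BddAbove (Set.range fun n => M n ω) := by
    have hev : ∀ᶠ n in atTop, M n ω ≤ m * failures k m ev x N := by
      filter_upwards [eventually_ge_atTop N] with n hn
      have h1 := (hN (n + 1) (by omega)).le_sum_weight (by omega) (fun s c => hev s ω c) hkD i hi
      rw [hfail _ (by omega)] at h1
      rw [hMω]
      linarith
    exact (Filter.isBoundedUnder_of_eventually_le hev).bddAbove_range
  obtain ⟨l, hl⟩ := hω1.1 hab
  have hξω : Tendsto (fun n => ξ (n + 1) ω) atTop (𝓝 0) := by
    have h1 := ((tendsto_add_atTop_iff_nat 1).2 hl).sub hl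
    rw [sub_self] at h1
    exact h1.congr fun n => congrFun (hMsucc n) ω
  have hne : ∀ᶠ s in atTop, x s ≠ i := by
    suffices h1 : ∀ᶠ n in atTop, x (n + 1) ≠ i by
      rwa [← map_add_atTop_eq_nat 1]
    filter_upwards [hξω.eventually (lt_mem_nhds (show (-1 : ℝ) < 0 by norm_num))] with n hn hxi
    have : ξ (n + 1) ω = -(m - k) := by
      change ψ (x (n + 1)) = _
      rw [hxi]
      simp [hψ, weight, hi]
    linarith
  obtain ⟨N', hN'⟩ := eventually_atTop.1 hne
  have hocc : ∀ t, N' ≤ t → occ x i t = occ x i N' := by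
    intro t ht
    induction t, ht using Nat.le_induction with
    | base => rfl
    | succ t ht ih => rw [occ_succ, ih, if_neg (hN' t ht), add_zero]
  have h0 : Tendsto (fun t : ℕ => (occ x i t : ℝ) / t) atTop (𝓝 0) := by
    refine (tendsto_const_div_atTop_nhds_zero_nat (occ x i N' : ℝ)).congr' ?_
    filter_upwards [eventually_ge_atTop N'] with t ht
    rw [hocc t ht]
  exact hpi.ne (tendsto_nhds_unique h0 (hω3 i))

theorem sum_top_eq_topMass (f : ℕ → ℝ) (hkD : k ≤ D) :
    ∑ i ∈ top D k, f ((i : ℕ) + 1) = topMass f k := by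
  refine Finset.sum_bij (fun i _ => (i : ℕ) + 1) ?_ ?_ ?_ fun _ _ => rfl
  · intro i hi
    have : (i : ℕ) < k := by simpa [top] using hi
    simp; omega
  · intro i _ j _ h
    exact Fin.ext (by omega)
  · intro n hn
    rw [Finset.mem_Icc] at hn
    exact ⟨⟨n - 1, by omega⟩, by simp [top]; omega, by simp; omega⟩

end Random

end SpaceSaving

/-! ### The criterion -/

theorem mainTheorem3 {Ω : Type*} [MeasurableSpace Ω] (μ : Measure Ω) [IsProbabilityMeasure μ]
    (D k m : ℕ) (hk : 1 ≤ k) (hkD : k < D) (hm : 1 ≤ m)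
    -- the item probabilities `f 1 ≥ … ≥ f k > f (k + 1) ≥ … ≥ f D`
    (f : ℕ → ℝ) (hf : AntitoneOn f (Set.Icc 1 D)) (hgap : f (k + 1) < f k)
    -- the i.i.d. stream
    (X : ℕ → Ω → Fin D) (hX : ∀ t, Measurable (X t)) (hindep : iIndepFun X μ)
    (hlaw : ∀ t, ∀ i : Fin D, μ.real {ω | X t ω = i} = f ((i : ℕ) + 1))
    -- the choice of the minimal counter among ties: arbitrary, possibly random or time-dependent
    (evict : ℕ → Ω → SpaceSaving.Table D → Fin D)
    (hevict_meas : ∀ t c, Measurable fun ω => evict t ω c)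
    (hevict : ∀ t ω c, (SpaceSaving.monitored c).Nonempty →
      SpaceSaving.IsArgmin c (evict t ω c)) :
    (k < m →
      (SpaceSaving.EventuallyIdentifies μ k m evict X ↔
        f k > (1 - SpaceSaving.topMass f k) / ((m : ℝ) - k))) ∧
    ((k < m ∨ SpaceSaving.topMass f k < 1) →
      (SpaceSaving.EventuallyIdentifies μ k m evict X ↔
        (m : ℝ) > k + (1 - SpaceSaving.topMass f k) / f k)) ∧
    ((m : ℝ) > k + (1 - SpaceSaving.topMass f k) / f k →
      Tendsto (SpaceSaving.identifyProb μ k m evict X) atTop (𝓝 1)) ∧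
    ((m : ℝ) < k + (1 - SpaceSaving.topMass f k) / f k →
      ¬ Tendsto (SpaceSaving.identifyProb μ k m evict X) atTop (𝓝 1)) := by
  have hm0 : 0 < m := hm
  set p : Fin D → ℝ := fun i => f ((i : ℕ) + 1) with hp
  have hpX : ∀ t i, μ.real {ω | X t ω = i} = p i := hlaw
  have hp0 : ∀ i, 0 ≤ p i := fun i => hpX 0 i ▸ measureReal_nonneg
  have hsum : ∑ i, p i = 1 := by
    simpa using (SpaceSaving.integral_comp_stream hX hpX (fun _ => 1) 0).symm
  have htop : ∑ i ∈ SpaceSaving.top D k, p i = SpaceSaving.topMass f k :=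
    SpaceSaving.sum_top_eq_topMass f hkD.le
  have hF1 : SpaceSaving.topMass f k ≤ 1 := by
    rw [← htop, ← hsum]
    exact Finset.sum_le_sum_of_subset_of_nonneg (Finset.subset_univ _) fun i _ _ => hp0 i
  set F := SpaceSaving.topMass f k with hF
  have hfk1 : 0 ≤ f (k + 1) := hp0 ⟨k, hkD⟩
  have hfk : 0 < f k := hfk1.trans_lt hgap
  have hpi : ∃ i : Fin D, (i : ℕ) < k ∧ p i = f k :=
    ⟨⟨k - 1, by omega⟩, by simp; omega, by simp only [hp]; congr 1; omega⟩
  obtain ⟨i, hik, hpi⟩ := hpi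
  have hsuff : (m : ℝ) > k + (1 - F) / f k → SpaceSaving.EventuallyIdentifies μ k m evict X := by
    intro h
    have hq : 0 ≤ (1 - F) / f k := div_nonneg (by linarith) hfk.le
    have hkm' : (0 : ℝ) < m - k := by linarith
    have hkm : k < m := by exact_mod_cast (sub_pos.1 hkm')
    have hρ : (1 - F) / (m - k) < f k := by
      rw [div_lt_iff₀ hkm', mul_comm, ← div_lt_iff₀ hfk]; linarith
    filter_upwards [SpaceSaving.ae_tendsto_occ_div hX hindep hpX] with ω hω
    refine SpaceSaving.eventually_identifies (fun t c => hevict t ω c) hkD.le hkm hω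
      (a := f k) (b := max ((1 - F) / (m - k)) (f (k + 1))) (max_lt hρ hgap) ?_ ?_ ?_
    · intro j hj
      exact hf ⟨by omega, by omega⟩ ⟨hk, hkD.le⟩ (by omega)
    · intro j hj
      exact (hf ⟨by omega, by omega⟩ ⟨by omega, j.2⟩ (by omega)).trans (le_max_right _ _)
    · rw [htop, ← div_le_iff₀' hkm']
      exact le_max_left _ _
  have hnec : (m : ℝ) < k + (1 - F) / f k →
      ¬ Tendsto (SpaceSaving.identifyProb μ k m evict X) atTop (𝓝 1) := by
    intro h hlim
    obtain ⟨-, h1⟩ := SpaceSaving.le_of_tendsto_identifyProb hX hpX hevict_meas hm0 hevict hkD.le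
      i hik hlim
    rw [htop, hpi] at h1
    have h2 : ((m : ℝ) - k) < (1 - F) / f k := by linarith
    rw [lt_div_iff₀ hfk] at h2
    linarith
  have hb : (k < m ∨ F < 1) → (SpaceSaving.EventuallyIdentifies μ k m evict X ↔
      (m : ℝ) > k + (1 - F) / f k) := by
    refine fun hor => ⟨fun h => ?_, hsuff⟩
    rcases lt_trichotomy (m : ℝ) (k + (1 - F) / f k) with hlt | heq | hgt
    · exact absurd h.tendsto_identifyProb (hnec hlt)
    · have hkm : k < m := by
        rcases hor with h | h
        · exact h
        · have : 0 < (1 - F) / f k := div_pos (by linarith) hfk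
          exact_mod_cast (by linarith : (k : ℝ) < m)
      refine absurd h (SpaceSaving.not_eventuallyIdentifies_of_critical hX hindep hpX hevict hkD.le
        hkm i hik (hpi ▸ hfk) ?_)
      rw [htop, hpi, heq, add_sub_cancel_left, div_mul_cancel₀ _ hfk.ne']
      ring
    · exact hgt
  refine ⟨fun hkm => ?_, hb, fun h => (hsuff h).tendsto_identifyProb, hnec⟩
  rw [hb (Or.inl hkm)]
  have hkm' : (0 : ℝ) < m - k := sub_pos.2 (by exact_mod_cast hkm)
  rw [gt_iff_lt, gt_iff_lt, div_lt_iff₀ hkm', ← lt_sub_iff_add_lt', div_lt_iff₀' hfk]
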